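/- Let $p$ be a prime and let $R=\bigoplus_{n\ge 0}R_n$ be a Noetherian commutative graded ring such that $k:=R_0$ is a field of characteristic $p$. Let $K$ be the perfect closure of $k$, and let $R_K:=R\otimes_k K$, graded by $(R_K)_n=R_n\otimes_k K$. Suppose that $R_K$ has finite graded F-representation type (defined below). Then for every non-zerodivisor $x\in R$, the localization $R_x$ is generated by $1/x$ as a $D_{R/k}$-module. Definitions. (a) Let $A=\bigoplus_{n\ge0}A_n$ be a graded ring of characteristic $p$. For an integer $e\ge 0$, ${}^e\!A$ denotes the abelian group $A$ with the $A$-module structure $r\cdot a:=r^{p^e}a$ and the $\mathbb{Q}$-grading $[{}^e\!A]_\alpha=A_{p^e\alpha}$ if $p^e\alpha$ is a nonnegative integer, and $[{}^e\!A]_\alpha=0$ otherwise. For a $\mathbb{Q}$-graded $A$-module $M$ and $\beta\in\mathbb{Q}$, $M(\beta)$ is the shifted module with $[M(\beta)]_\alpha=[M]_{\alpha+\beta}$. The ring $A$ has finite graded F-representation type if there are finitely generated $\mathbb{Q}$-graded $A$-modules $M_1,\dots,M_s$ such that for every $e\ge 0$ there are integers $n_{e1},\dots,n_{es}\ge 0$,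 rational numbers $\alpha^{(e)}_{ij}$ ($1\le i\le s$, $1\le j\le n_{ei}$), and an isomorphism of $\mathbb{Q}$-graded $A$-modules ${}^e\!A\cong\bigoplus_{i=1}^s\bigoplus_{j=1}^{n_{ei}}M_i(\alpha^{(e)}_{ij})$. (b) $D_{R/k}=\bigcup_{n\ge0}D^n_{R/k}\subseteq \mathrm{End}_k(R)$ is the ring of $k$-linear differential operators, where $D^{-1}_{R/k}=0$ and $D^{n+1}_{R/k}=\{\delta\in\mathrm{End}_k(R) : \delta\circ r-r\circ\delta\in D^n_{R/k}\text{ for all }r\in R\}$. Every $\delta\in D_{R/k}$ is linear over the subring $\{r^q: r\in R\}$ for all sufficiently large powers $q$ of $p$, and $R_x$ is a $D_{R/k}$-module via $\delta(y/s)=\delta(s^{q-1}y)/s^q$ for such $q$, where $y\in R$ and $s$ is a power of $x$. -/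

import Mathlib

open scoped TensorProduct

universe u v w

/-! ### Rings of differential operators -/

section DifferentialOperators

variable (k : Type u) (R : Type v) [CommRing k] [CommRing R] [Algebra k R]

/-- `diffOpLT k R n` is the space of `k`-linear differential operators on `R` of order `< n`, that
is `D^{n-1}_{R/k}`: one has `D^{-1} = 0`, and `δ ∈ D^n` iff `[δ, r] = δ ∘ r - r ∘ δ ∈ D^{n-1}` for
all `r ∈ R`. -/
def diffOpLT : ℕ → Submodule k (Module.End k R)
  | 0 => ⊥
  | n + 1 =>
    { carrier := {δ | ∀ r : R,
        δ * LinearMap.mulLeft k r - LinearMap.mulLeft k r * δ ∈ diffOpLT n}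
      zero_mem' := fun r => by simp
      add_mem' := fun {a b} ha hb r => by
        have h := (diffOpLT n).add_mem (ha r) (hb r)
        have e : (a + b) * LinearMap.mulLeft k r - LinearMap.mulLeft k r * (a + b) =
          (a * LinearMap.mulLeft k r - LinearMap.mulLeft k r * a) +
          (b * LinearMap.mulLeft k r - LinearMap.mulLeft k r * b) := by noncomm_ring
        rw [e]; exact h
      smul_mem' := fun c a ha r => by
        have h := (diffOpLT n).smul_mem c (ha r)
        have e : (c • a) * LinearMap.mulLeft k r - LinearMap.mulLeft k r * (c • a) =
          c • (a * LinearMap.mulLeft k r - LinearMap.mulLeft k r * a) := by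
          rw [smul_mul_assoc, mul_smul_comm, smul_sub]
        rw [e]; exact h }

variable {k R}

theorem mem_diffOpLT_succ {n : ℕ} {δ : Module.End k R} :
    δ ∈ diffOpLT k R (n + 1) ↔
      ∀ r : R, δ * LinearMap.mulLeft k r - LinearMap.mulLeft k r * δ ∈ diffOpLT k R n :=
  Iff.rfl

theorem diffOpLT_le_succ (n : ℕ) : diffOpLT k R n ≤ diffOpLT k R (n + 1) := by
  induction n with
  | zero => exact bot_le
  | succ n ih => exact fun δ hδ r => ih (hδ r)

theorem diffOpLT_mono : Monotone (diffOpLT k R) := monotone_nat_of_le_succ diffOpLT_le_succ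

theorem diffOpLT_mul {m n : ℕ} {δ ε : Module.End k R} (hδ : δ ∈ diffOpLT k R m)
    (hε : ε ∈ diffOpLT k R n) : δ * ε ∈ diffOpLT k R (m + n) := by
  induction hN : m + n generalizing m n δ ε with
  | zero =>
    obtain rfl : m = 0 := by omega
    have h : δ = 0 := hδ
    simp [h]
  | succ N ih =>
    rcases m with _ | m
    · have h : δ = 0 := hδ
      simp [h]
    rcases n with _ | n
    · have h : ε = 0 := hε
      simp [h]
    intro r
    have h1 := ih hδ (hε r) (by omega)
    have h2 := ih (hδ r) hε (by omega)
    have e : δ * ε * LinearMap.mulLeft k r - LinearMap.mulLeft k r * (δ * ε) =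
        δ * (ε * LinearMap.mulLeft k r - LinearMap.mulLeft k r * ε) +
        (δ * LinearMap.mulLeft k r - LinearMap.mulLeft k r * δ) * ε := by
      simp only [mul_sub, sub_mul, mul_assoc]; abel
    rw [e]
    exact (diffOpLT k R N).add_mem h1 h2

theorem algebraMap_mem_diffOpLT_one (c : k) :
    algebraMap k (Module.End k R) c ∈ diffOpLT k R 1 := by
  intro r
  have h : algebraMap k (Module.End k R) c * LinearMap.mulLeft k r -
      LinearMap.mulLeft k r * algebraMap k (Module.End k R) c = 0 := by
    rw [sub_eq_zero]; exact Algebra.commutes _ _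
  rw [h]; exact Submodule.zero_mem _

variable (k R)

/-- The ring `D_{R/k} = ⋃ₙ D^n_{R/k}` of `k`-linear differential operators on `R`. -/
def DiffOp : Subalgebra k (Module.End k R) where
  carrier := {δ | ∃ n, δ ∈ diffOpLT k R n}
  mul_mem' := fun ⟨_, ha⟩ ⟨_, hb⟩ => ⟨_, diffOpLT_mul ha hb⟩
  add_mem' := fun ⟨m, ha⟩ ⟨n, hb⟩ => ⟨max m n, (diffOpLT k R _).add_mem
    (diffOpLT_mono (le_max_left m n) ha) (diffOpLT_mono (le_max_right m n) hb)⟩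
  algebraMap_mem' := fun c => ⟨1, algebraMap_mem_diffOpLT_one c⟩

end DifferentialOperators

/-! ### The action of differential operators on localizations in characteristic `p` -/

section LocalizationAction

variable {k : Type u} {R : Type v} [CommRing k] [CommRing R] [Algebra k R]

/-- `δ` is linear over the subring `R^q` of `q`-th powers, where `q = p ^ e`. -/
def IsFrobLinear (p e : ℕ) (δ : Module.End k R) : Prop :=
  ∀ r y : R, δ (r ^ p ^ e * y) = r ^ p ^ e * δ y

theorem isFrobLinear_of_mem (p : ℕ) [CharP R p] {n : ℕ} {δ : Module.End k R}
    (hδ : δ ∈ diffOpLT k R n) : IsFrobLinear p n δ := by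
  induction n generalizing δ with
  | zero =>
    have h : δ = 0 := hδ
    intro r y
    simp [h]
  | succ n ih =>
    intro r y
    have hs : ∀ (m : ℕ) (y : R), δ ((r ^ p ^ n) ^ m * y) =
        (r ^ p ^ n) ^ m * δ y +
          m * (r ^ p ^ n) ^ (m - 1) * (δ (r ^ p ^ n * y) - r ^ p ^ n * δ y) := by
      intro m
      induction m with
      | zero => intro y; simp
      | succ m ihm =>
        intro y
        have h1 := ihm (r ^ p ^ n * y)
        have h2 := ih (hδ (r ^ p ^ n)) r y
        simp only [LinearMap.sub_apply, Module.End.mul_apply, LinearMap.mulLeft_apply] at h2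
        rw [pow_succ, mul_assoc, h1]
        rcases m with _ | m
        · simp
        · simp only [Nat.add_sub_cancel] at *
          push_cast
          linear_combination ((m : R) + 1) * (r ^ p ^ n) ^ m * h2
    rw [pow_succ, pow_mul, hs p y, CharP.cast_eq_zero]
    ring

theorem DiffOp.exists_isFrobLinear (p : ℕ) [CharP R p] (δ : DiffOp k R) :
    ∃ e, IsFrobLinear p e (δ : Module.End k R) := by
  obtain ⟨n, hn⟩ := δ.2
  exact ⟨n, isFrobLinear_of_mem p hn⟩

theorem IsFrobLinear.mono {p e e' : ℕ} {δ : Module.End k R} (h : IsFrobLinear p e δ)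
    (hee : e ≤ e') : IsFrobLinear p e' δ := by
  intro r y
  obtain ⟨d, rfl⟩ := Nat.exists_eq_add_of_le hee
  have hr : r ^ p ^ (e + d) = (r ^ p ^ d) ^ p ^ e := by rw [← pow_mul, pow_add, mul_comm]
  rw [hr]
  exact h _ _

variable (M : Submonoid R)

/-- The fraction `δ(s^{q-1} y) / s^q`, where `q = p ^ e`. -/
noncomputable def locFrac (p e : ℕ) (δ : Module.End k R) (y : R) (s : M) : Localization M :=
  IsLocalization.mk' (Localization M) (δ ((s : R) ^ (p ^ e - 1) * y)) (s ^ p ^ e)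

variable {M}

theorem locFrac_succ_le {p e e' : ℕ} (hp : 0 < p) {δ : Module.End k R} (h : IsFrobLinear p e δ)
    (hee : e ≤ e') (y : R) (s : M) : locFrac M p e' δ y s = locFrac M p e δ y s := by
  obtain ⟨d, rfl⟩ := Nat.exists_eq_add_of_le hee
  unfold locFrac
  rw [IsLocalization.mk'_eq_iff_eq]
  have hq : 0 < p ^ e := Nat.pow_pos hp
  have hd : 0 < p ^ d := Nat.pow_pos hp
  obtain ⟨a, ha⟩ : ∃ a, p ^ d = a + 1 := ⟨p ^ d - 1, by omega⟩
  have e1 : p ^ (e + d) - 1 = a * p ^ e + (p ^ e - 1) := by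
    rw [pow_add, ha, mul_add, mul_one, mul_comm a]; omega
  have e2 : p ^ (e + d) = a * p ^ e + p ^ e := by rw [pow_add, ha]; ring
  rw [e1, pow_add, pow_mul, mul_assoc, h]
  congr 1
  push_cast
  rw [e2]
  ring

theorem locFrac_congr {p e : ℕ} (hp : 0 < p) {δ : Module.End k R} (h : IsFrobLinear p e δ)
    {y y' : R} {s s' : M}
    (hys : IsLocalization.mk' (Localization M) y s = IsLocalization.mk' (Localization M) y' s') :
    locFrac M p e δ y s = locFrac M p e δ y' s' := by
  unfold locFrac
  rw [IsLocalization.eq] at hys ⊢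
  obtain ⟨c, hc⟩ := hys
  refine ⟨c ^ p ^ e, ?_⟩
  obtain ⟨a, ha⟩ : ∃ a, p ^ e = a + 1 := ⟨p ^ e - 1, by have := Nat.pow_pos (n := e) hp; omega⟩
  have h1 := h (c * s') ((s : R) ^ (p ^ e - 1) * y)
  have h2 := h (c * s) ((s' : R) ^ (p ^ e - 1) * y')
  have h3 : ((c : R) * s') ^ p ^ e * ((s : R) ^ (p ^ e - 1) * y) =
      (c * s) ^ p ^ e * ((s' : R) ^ (p ^ e - 1) * y') := by
    rw [ha]
    simp only [Nat.add_sub_cancel]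
    linear_combination (c : R) ^ a * (s : R) ^ a * (s' : R) ^ a * hc
  rw [h3] at h1
  push_cast
  linear_combination h2 - h1

/-- The action of a differential operator `δ` on a localization: `δ(y/s) = δ(s^{q-1} y) / s^q` for
any `q = p ^ e` such that `δ` is `R^q`-linear. -/
noncomputable def DiffOp.locFun (p : ℕ) [CharP R p] (M : Submonoid R) (δ : DiffOp k R)
    (m : Localization M) : Localization M :=
  locFrac M p (DiffOp.exists_isFrobLinear p δ).choose (δ : Module.End k R)
    (IsLocalization.sec M m).1 (IsLocalization.sec M m).2

/-- The value of the action does not depend on the choices. -/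
theorem DiffOp.locFun_mk' (p : ℕ) [hp : Fact p.Prime] [CharP R p] (δ : DiffOp k R) {e : ℕ}
    (h : IsFrobLinear p e (δ : Module.End k R)) (y : R) (s : M) :
    DiffOp.locFun p M δ (IsLocalization.mk' (Localization M) y s) =
      IsLocalization.mk' (Localization M)
        ((δ : Module.End k R) ((s : R) ^ (p ^ e - 1) * y)) (s ^ p ^ e) := by
  have h0 := (DiffOp.exists_isFrobLinear p δ).choose_spec
  unfold DiffOp.locFun
  set e0 := (DiffOp.exists_isFrobLinear p δ).choose
  rw [locFrac_congr hp.out.pos h0 (IsLocalization.mk'_sec (Localization M) _),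
    ← locFrac_succ_le hp.out.pos h0 (le_max_left e0 e),
    locFrac_succ_le hp.out.pos h (le_max_right e0 e)]
  rfl

theorem exists_mk'_pair (m m' : Localization M) : ∃ (a a' : R) (s : M),
    m = IsLocalization.mk' (Localization M) a s ∧
      m' = IsLocalization.mk' (Localization M) a' s := by
  obtain ⟨a, s, rfl⟩ := IsLocalization.exists_mk'_eq M m
  obtain ⟨a', s', rfl⟩ := IsLocalization.exists_mk'_eq M m'
  refine ⟨a * s', a' * s, s * s', ?_, ?_⟩
  · rw [IsLocalization.mk'_eq_iff_eq]; congr 1; push_cast; ring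
  · rw [IsLocalization.mk'_eq_iff_eq]; congr 1; push_cast; ring

theorem mk'_add_same (a a' : R) (s : M) :
    IsLocalization.mk' (Localization M) (a + a') s =
      IsLocalization.mk' (Localization M) a s + IsLocalization.mk' (Localization M) a' s := by
  rw [IsLocalization.mk'_eq_mul_mk'_one, IsLocalization.mk'_eq_mul_mk'_one a,
    IsLocalization.mk'_eq_mul_mk'_one a', map_add, add_mul]

theorem smul_mk'_same (c : k) (a : R) (s : M) :
    c • IsLocalization.mk' (Localization M) a s =
      IsLocalization.mk' (Localization M) (c • a) s := by
  rw [IsLocalization.mk'_eq_mul_mk'_one, IsLocalization.mk'_eq_mul_mk'_one (c • a),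
    Algebra.smul_def c a, map_mul, mul_assoc,
    ← IsScalarTower.algebraMap_apply k R (Localization M), Algebra.smul_def c]

theorem DiffOp.locFun_op_add (p : ℕ) [Fact p.Prime] [CharP R p] (δ ε : DiffOp k R)
    (m : Localization M) :
    DiffOp.locFun p M (δ + ε) m = DiffOp.locFun p M δ m + DiffOp.locFun p M ε m := by
  obtain ⟨a, s, rfl⟩ := IsLocalization.exists_mk'_eq M m
  obtain ⟨e, he⟩ := DiffOp.exists_isFrobLinear p δ
  obtain ⟨e', he'⟩ := DiffOp.exists_isFrobLinear p ε
  have h1 := he.mono (le_max_left e e')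
  have h2 := he'.mono (le_max_right e e')
  have h3 : IsFrobLinear p (max e e') ((δ + ε : DiffOp k R) : Module.End k R) := by
    intro r y
    simp only [Subalgebra.coe_add, LinearMap.add_apply, h1 r y, h2 r y, mul_add]
  rw [DiffOp.locFun_mk' p _ h1, DiffOp.locFun_mk' p _ h2, DiffOp.locFun_mk' p _ h3,
    ← mk'_add_same]
  rfl

theorem DiffOp.locFun_op_smul (p : ℕ) [Fact p.Prime] [CharP R p] (c : k) (δ : DiffOp k R)
    (m : Localization M) :
    DiffOp.locFun p M (c • δ) m = c • DiffOp.locFun p M δ m := by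
  obtain ⟨a, s, rfl⟩ := IsLocalization.exists_mk'_eq M m
  obtain ⟨e, h1⟩ := DiffOp.exists_isFrobLinear p δ
  have h3 : IsFrobLinear p e ((c • δ : DiffOp k R) : Module.End k R) := by
    intro r y
    simp only [Subalgebra.coe_smul, LinearMap.smul_apply, h1 r y, mul_smul_comm]
  rw [DiffOp.locFun_mk' p _ h1, DiffOp.locFun_mk' p _ h3, smul_mk'_same]
  rfl

theorem DiffOp.locFun_op_one (p : ℕ) [Fact p.Prime] [CharP R p] (m : Localization M) :
    DiffOp.locFun p M (1 : DiffOp k R) m = m := by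
  obtain ⟨a, s, rfl⟩ := IsLocalization.exists_mk'_eq M m
  have h : IsFrobLinear p 0 ((1 : DiffOp k R) : Module.End k R) := fun r y => rfl
  rw [DiffOp.locFun_mk' p _ h]
  simp

theorem DiffOp.locFun_op_mul (p : ℕ) [Fact p.Prime] [CharP R p] (δ ε : DiffOp k R)
    (m : Localization M) :
    DiffOp.locFun p M (δ * ε) m = DiffOp.locFun p M δ (DiffOp.locFun p M ε m) := by
  obtain ⟨a, s, rfl⟩ := IsLocalization.exists_mk'_eq M m
  obtain ⟨e, he⟩ := DiffOp.exists_isFrobLinear p δ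
  obtain ⟨e', he'⟩ := DiffOp.exists_isFrobLinear p ε
  have h1 := he.mono (le_max_left e e')
  have h2 := he'.mono (le_max_right e e')
  generalize max e e' = E at h1 h2
  have h3 : IsFrobLinear p E ((δ * ε : DiffOp k R) : Module.End k R) := by
    intro r y
    simp only [Subalgebra.coe_mul, Module.End.mul_apply, h1 r _, h2 r y]
  rw [DiffOp.locFun_mk' p _ h2, DiffOp.locFun_mk' p _ h1, DiffOp.locFun_mk' p _ h3,
    IsLocalization.mk'_eq_iff_eq]
  congr 1
  obtain ⟨b, hb⟩ : ∃ b, p ^ E = b + 1 :=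
    ⟨p ^ E - 1, by have := Nat.pow_pos (n := E) (Fact.out : p.Prime).pos; omega⟩
  have h4 := h1 ((s : R) ^ (p ^ E - 1)) ((ε : Module.End k R) ((s : R) ^ (p ^ E - 1) * a))
  have h5 : ((s ^ p ^ E : M) : R) ^ (p ^ E - 1) = ((s : R) ^ (p ^ E - 1)) ^ p ^ E := by
    push_cast
    rw [← pow_mul, ← pow_mul, mul_comm]
  rw [h5, h4]
  simp only [Subalgebra.coe_mul, Module.End.mul_apply, SubmonoidClass.coe_pow]
  generalize (δ : Module.End k R) ((ε : Module.End k R) ((s : R) ^ (p ^ E - 1) * a)) = t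
  have h6 : (s : R) ^ p ^ E = (s : R) ^ (p ^ E - 1) * s := by
    rw [hb, Nat.add_sub_cancel, pow_succ]
  generalize (s : R) ^ (p ^ E - 1) = z at h6
  rw [h6, mul_pow]
  generalize p ^ E = q at h6
  linear_combination t * z ^ q * h6

/-- The localization of `R` at `M` as a representation of the ring `D_{R/k}`. -/
noncomputable def DiffOp.locHom (p : ℕ) [Fact p.Prime] [CharP R p] (M : Submonoid R) :
    DiffOp k R →+* Module.End k (Localization M) where
  toFun δ :=
    { toFun := DiffOp.locFun p M δ
      map_add' := fun m m' => by
        obtain ⟨a, a', s, rfl, rfl⟩ := exists_mk'_pair m m'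
        obtain ⟨e, he⟩ := DiffOp.exists_isFrobLinear p δ
        rw [← mk'_add_same, DiffOp.locFun_mk' p δ he, DiffOp.locFun_mk' p δ he,
          DiffOp.locFun_mk' p δ he, ← mk'_add_same, mul_add, map_add]
      map_smul' := fun c m => by
        obtain ⟨a, s, rfl⟩ := IsLocalization.exists_mk'_eq M m
        obtain ⟨e, he⟩ := DiffOp.exists_isFrobLinear p δ
        rw [smul_mk'_same, DiffOp.locFun_mk' p δ he, DiffOp.locFun_mk' p δ he,
          RingHom.id_apply, smul_mk'_same, mul_smul_comm, map_smul] }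
  map_one' := LinearMap.ext fun m => DiffOp.locFun_op_one p m
  map_mul' δ ε := LinearMap.ext fun m => DiffOp.locFun_op_mul p δ ε m
  map_zero' := LinearMap.ext fun m => by
    have h := DiffOp.locFun_op_smul (M := M) p (0 : k) (0 : DiffOp k R) m
    rwa [zero_smul, zero_smul] at h
  map_add' δ ε := LinearMap.ext fun m => DiffOp.locFun_op_add p δ ε m

/-- The `D_{R/k}`-module structure on the localization of `R` at `M`, for `R` of characteristic
`p`. -/
@[reducible]
noncomputable def DiffOp.locModule (p : ℕ) [Fact p.Prime] [CharP R p] (k : Type u) [CommRing k]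
    [Algebra k R] (M : Submonoid R) : Module (DiffOp k R) (Localization M) :=
  Module.compHom (Localization M) (DiffOp.locHom (k := k) p M)

/-- The localization map `R → M⁻¹R` is `D_{R/k}`-linear. -/
theorem DiffOp.locHom_algebraMap (p : ℕ) [Fact p.Prime] [CharP R p] (δ : DiffOp k R) (r : R) :
    DiffOp.locHom p M δ (algebraMap R (Localization M) r) =
      algebraMap R (Localization M) ((δ : Module.End k R) r) := by
  obtain ⟨e, he⟩ := DiffOp.exists_isFrobLinear p δ
  rw [← IsLocalization.mk'_one (M := M) (Localization M) r]
  refine (DiffOp.locFun_mk' p δ he r 1).trans ?_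
  simp only [OneMemClass.coe_one, one_pow, one_mul]
  exact IsLocalization.mk'_one _ _

end LocalizationAction

/-! ### Frobenius push-forwards -/

section FrobeniusPushforward

/-- `FrobModule p e N` is `ᵉN`: the module `N` over a ring `A` of characteristic `p`, with its
module structure pulled back along the `e`-th iterate of the Frobenius map of `A`. -/
def FrobModule (_p _e : ℕ) (N : Type w) : Type w := N

variable {A : Type u} [CommRing A] {N : Type w} [AddCommGroup N] [Module A N]

instance (p e : ℕ) : AddCommGroup (FrobModule p e N) := inferInstanceAs (AddCommGroup N)

noncomputable instance FrobModule.instModule (p : ℕ) [Fact p.Prime] [CharP A p] (e : ℕ) :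
    Module A (FrobModule p e N) :=
  Module.compHom N (iterateFrobenius A p e)

theorem FrobModule.smul_def (p : ℕ) [Fact p.Prime] [CharP A p] (e : ℕ) (a : A) (m : N) :
    (a • (show FrobModule p e N from m) : FrobModule p e N) =
      (show FrobModule p e N from a ^ p ^ e • m) :=
  rfl

end FrobeniusPushforward

/-! ### `ℚ`-graded modules -/

theorem isInternal_iff_addSubgroup {ι : Type*} [DecidableEq ι] {N : Type*} [AddCommGroup N]
    (P : ι → AddSubgroup N) : DirectSum.IsInternal P ↔ iSupIndep P ∧ iSup P = ⊤ := by
  have h1 : iSup P = ⊤ ↔ iSup (fun i => (P i).toAddSubmonoid) = ⊤ := by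
    constructor
    · intro h
      rw [eq_top_iff]
      intro x _
      have hx : x ∈ iSup P := h ▸ AddSubgroup.mem_top x
      induction hx using AddSubgroup.iSup_induction' with
      | hp i x hx => exact AddSubmonoid.mem_iSup_of_mem i hx
      | h1 => exact zero_mem _
      | hadd x y _ _ ihx ihy => exact add_mem (ihx trivial) (ihy trivial)
    · intro h
      rw [eq_top_iff]
      intro x _
      have hx : x ∈ iSup (fun i => (P i).toAddSubmonoid) := h ▸ AddSubmonoid.mem_top x
      have hle : iSup (fun i => (P i).toAddSubmonoid) ≤ (iSup P).toAddSubmonoid :=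
        iSup_le fun i y hy => AddSubgroup.mem_iSup_of_mem i hy
      exact hle hx
  rw [h1, iSupIndep_iff_dfinsuppSumAddHom_injective,
    AddSubmonoid.iSup_eq_mrange_dfinsuppSumAddHom, AddMonoidHom.mrange_eq_top]
  exact Iff.rfl

theorem isInternal_comp_equiv {ι κ : Type*} [DecidableEq ι] [DecidableEq κ] {N : Type*}
    [AddCommGroup N] {P : ι → AddSubgroup N} (h : DirectSum.IsInternal P) (f : κ ≃ ι) :
    DirectSum.IsInternal fun j => P (f j) := by
  rw [isInternal_iff_addSubgroup] at h ⊢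
  exact ⟨h.1.comp f.injective, by rw [← h.2]; exact f.iSup_comp⟩

theorem isInternal_extend {ι κ : Type*} [DecidableEq ι] [DecidableEq κ] {N : Type*}
    [AddCommGroup N] {P : ι → AddSubgroup N} (h : DirectSum.IsInternal P) {f : ι → κ}
    (hf : Function.Injective f) : DirectSum.IsInternal (Function.extend f P ⊥) := by
  rw [isInternal_iff_addSubgroup] at h ⊢
  have key : ∀ (T : Set κ) (B : AddSubgroup N), (∀ i, f i ∈ T → P i ≤ B) →
      ⨆ j ∈ T, Function.extend f P ⊥ j ≤ B := by
    intro T B hB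
    refine iSup₂_le fun j hj => ?_
    by_cases hjf : ∃ i, f i = j
    · obtain ⟨i, rfl⟩ := hjf
      rw [hf.extend_apply]
      exact hB i hj
    · rw [Function.extend_apply' _ _ _ hjf]
      exact bot_le
  constructor
  · intro j
    by_cases hjf : ∃ i, f i = j
    · obtain ⟨i, rfl⟩ := hjf
      rw [hf.extend_apply]
      refine (h.1 i).mono_right (key {j | j ≠ f i} _ fun i' hi' => ?_)
      exact le_iSup₂_of_le i' (fun hii => hi' (by rw [hii])) le_rfl
    · rw [Function.extend_apply' _ _ _ hjf]
      exact disjoint_bot_left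
  · rw [eq_top_iff, ← h.2]
    exact iSup_le fun i => le_iSup_of_le (f i) (by rw [hf.extend_apply])

theorem isInternal_pi {ι κ : Type*} [DecidableEq κ] [Fintype ι] {N : ι → Type*}
    [∀ i, AddCommGroup (N i)] {P : ∀ i, κ → AddSubgroup (N i)}
    (h : ∀ i, DirectSum.IsInternal (P i)) :
    DirectSum.IsInternal fun j => AddSubgroup.pi Set.univ fun i => P i j := by
  classical
  simp only [isInternal_iff_addSubgroup] at h ⊢
  constructor
  · intro j
    rw [AddSubgroup.disjoint_def]
    intro x hx hx'
    ext i
    have hle : (⨆ j', ⨆ _ : j' ≠ j, AddSubgroup.pi Set.univ fun i => P i j') ≤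
        (⨆ j', ⨆ _ : j' ≠ j, P i j').comap (Pi.evalAddMonoidHom N i) :=
      iSup₂_le fun j' hj' y hy =>
        (le_iSup₂_of_le (f := fun j' (_ : j' ≠ j) => P i j') j' hj' le_rfl) (hy i trivial)
    exact AddSubgroup.disjoint_def.1 ((h i).1 j) (hx i trivial) (hle hx')
  · rw [eq_top_iff]
    intro x _
    rw [← Finset.univ_sum_single x]
    refine AddSubgroup.sum_mem _ fun i _ => ?_
    have hle : (⊤ : AddSubgroup (N i)) ≤
        (⨆ j, AddSubgroup.pi Set.univ fun i => P i j).comap (AddMonoidHom.single N i) := by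
      rw [← (h i).2]
      refine iSup_le fun j y hy => AddSubgroup.mem_iSup_of_mem j ?_
      intro i' _
      by_cases hi : i' = i
      · subst hi
        simpa using hy
      · simp [Pi.single_eq_of_ne hi]
    exact hle (AddSubgroup.mem_top (x i))

section QGraded

variable {A : Type u} [CommRing A] {σ : Type*} [SetLike σ A] [AddSubgroupClass σ A]

/-- A `ℚ`-graded module over the `ℕ`-graded ring `A = ⨁ₙ 𝒜 n`. -/
structure QGradedModule (𝒜 : ℕ → σ) where
  carrier : Type u
  [addCommGroup : AddCommGroup carrier]
  [module : Module A carrier]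
  /-- the homogeneous elements of a given degree -/
  piece : ℚ → AddSubgroup carrier
  isInternal : DirectSum.IsInternal piece
  smul_mem : ∀ {n : ℕ} {α : ℚ} {a : A} {m : carrier},
    a ∈ 𝒜 n → m ∈ piece α → a • m ∈ piece (n + α)

attribute [instance] QGradedModule.addCommGroup QGradedModule.module

namespace QGradedModule

/-- The ring `A` itself as a `ℚ`-graded module: the piece of degree `α` is `𝒜 n` if `α = n ∈ ℕ`,
and zero otherwise. -/
noncomputable def ofRing (𝒜 : ℕ → σ) [GradedRing 𝒜] : QGradedModule 𝒜 where
  carrier := A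
  piece := Function.extend (fun n : ℕ => (n : ℚ)) (fun n => AddSubgroup.ofClass (𝒜 n)) ⊥
  isInternal := isInternal_extend (DirectSum.Decomposition.isInternal 𝒜) Nat.cast_injective
  smul_mem := fun {n α a m} ha hm => by
    by_cases h : ∃ l : ℕ, (l : ℚ) = α
    · obtain ⟨l, rfl⟩ := h
      rw [Nat.cast_injective.extend_apply] at hm
      rw [← Nat.cast_add, Nat.cast_injective.extend_apply]
      exact SetLike.mul_mem_graded ha hm
    · rw [Function.extend_apply' _ _ _ h] at hm
      have hm0 : m = 0 := hm
      rw [hm0, smul_zero]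
      exact zero_mem _

variable {𝒜 : ℕ → σ}

/-- The `ℚ`-graded module `ᵉN`, with `[ᵉN]_α = [N]_{p^e α}`. -/
noncomputable def frob [GradedRing 𝒜] (p : ℕ) [hp : Fact p.Prime] [CharP A p] (e : ℕ) (N : QGradedModule 𝒜) :
    QGradedModule 𝒜 where
  carrier := FrobModule p e N.carrier
  piece α := N.piece (p ^ e * α)
  isInternal := isInternal_comp_equiv N.isInternal
    (Equiv.mulLeft₀ ((p : ℚ) ^ e) (pow_ne_zero _ (Nat.cast_ne_zero.2 hp.out.ne_zero)))
  smul_mem := fun {n α a m} ha hm => by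
    have h : a ^ p ^ e ∈ 𝒜 (p ^ e * n) := SetLike.pow_mem_graded (p ^ e) ha
    have h2 := N.smul_mem h hm
    push_cast at h2
    rw [mul_add]
    exact h2

/-- The shifted module `N(β)`, with `[N(β)]_α = [N]_{β + α}`. -/
def shift (N : QGradedModule 𝒜) (β : ℚ) : QGradedModule 𝒜 where
  carrier := N.carrier
  piece α := N.piece (β + α)
  isInternal := isInternal_comp_equiv N.isInternal (Equiv.addLeft β)
  smul_mem := fun {n α a m} ha hm => by
    have h := N.smul_mem ha hm
    rwa [add_left_comm] at h

/-- The direct sum of a finite family of `ℚ`-graded modules. -/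
def directSum {ι : Type} [Fintype ι] (N : ι → QGradedModule 𝒜) : QGradedModule 𝒜 where
  carrier := ∀ i, (N i).carrier
  piece α := AddSubgroup.pi Set.univ fun i => (N i).piece α
  isInternal := isInternal_pi fun i => (N i).isInternal
  smul_mem := fun ha hm i _ => (N i).smul_mem ha (hm i trivial)

/-- Isomorphisms of `ℚ`-graded modules: linear isomorphisms which preserve degrees. -/
structure Iso (N N' : QGradedModule 𝒜) where
  toLinearEquiv : N.carrier ≃ₗ[A] N'.carrier
  mem_piece_iff : ∀ (α : ℚ) (m : N.carrier), m ∈ N.piece α ↔ toLinearEquiv m ∈ N'.piece α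

end QGradedModule

/-- The graded ring `A = ⨁ₙ 𝒜 n` of characteristic `p` has finite graded F-representation type:
there are finitely generated `ℚ`-graded modules `M₁, …, M_s` such that, for every `e`, `ᵉA` is
isomorphic as a `ℚ`-graded module to a finite direct sum of shifts of the `M_i`. -/
def HasFiniteGradedFRepType (p : ℕ) [Fact p.Prime] [CharP A p] (𝒜 : ℕ → σ) [GradedRing 𝒜] :
    Prop :=
  ∃ (s : ℕ) (M : Fin s → QGradedModule 𝒜), (∀ i, Module.Finite A (M i).carrier) ∧
    ∀ e : ℕ, ∃ (n : Fin s → ℕ) (α : ∀ i, Fin (n i) → ℚ),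
      Nonempty (QGradedModule.Iso ((QGradedModule.ofRing 𝒜).frob p e)
        (QGradedModule.directSum fun ij : (i : Fin s) × Fin (n i) =>
          (M ij.1).shift (α ij.1 ij.2)))

end QGraded

/-- The scalar extension `K ⊗ R` of a `k`-algebra of characteristic `p` has characteristic `p`. -/
instance charP_tensorProduct (k : Type u) (K : Type v) (R : Type w) [Field k] [Field K]
    [Algebra k K] [CommRing R] [Algebra k R] (p : ℕ) [Fact p.Prime] [CharP K p] [CharP R p] :
    CharP (K ⊗[k] R) p :=
  haveI : Nontrivial R := CharP.nontrivial_of_char_ne_one (Fact.out : p.Prime).ne_one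
  charP_of_injective_algebraMap (algebraMap K (K ⊗[k] R)).injective p

/-!
Write `A` for `K ⊗ R`. The element `1/x` generates `R_x` as soon as, for every `f`, some
differential operator of `R` sends `1/x` to `1/x ^ p ^ f`, that is, sends `x ^ (p ^ e - 1)` to
`x ^ (p ^ e - p ^ f)` for some large `e` (`span_invSelf_eq_top`).

Such operators are first found over `A`, as endomorphisms of the `A`-module `ᵉA`. Let `M_i` be the
modules of which all `ᵉA` are composed, and let `L_e ⊆ M_i` be the submodule of the images of
`x ^ (p ^ e - 1)` under all linear maps `ᵉA → M_i` (`frobImage`). Composing with Frobenius maps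
`ᵉA → ᵉ⁺ᶠA` shows that `L_e` decreases with `e`, and that the components of `x ^ (p ^ e - p ^ f)`
in `ᵉA ≅ ⨁ M_i(α_ij)` lie in `L_{e-f}`. The grading makes up for the missing descending chain
condition: `ᵉA` lives in nonnegative degrees, so the shifts `α_ij` are bounded above by the degree
of any nonzero homogeneous element of `M_i`, and `x ^ (p ^ e - p ^ f)` has degree at most `deg x`
in `ᵉA`. Hence its components lie in a part of `M_i` of bounded degree, which is
finite-dimensional over `K`, and there the chain `L_e` is stationary
(`QGradedModule.exists_stationary_degreeLE`). So for large `e` the components lie in `L_e`, and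
linear maps `ᵉA → M_i` sending `x ^ (p ^ e - 1)` to them combine to the endomorphism
(`HasFiniteGradedFRepType.exists_end_apply_eq`).

This endomorphism is linear over `p ^ e`-th powers, hence `K`-linear because `K` is perfect. A
`k`-linear retraction `K → k` turns it into a `k`-linear endomorphism of `R` which is linear over
`p ^ e`-th powers (`exists_isFrobLinear_of_baseChange`); since `R` is a finitely generated
`k`-algebra, this is a differential operator (`IsFrobLinear.mem_diffOp`).
-/

/-! ### Differential operators and Frobenius-linear maps -/

section FrobLinear

variable (k : Type u) (R : Type v) [CommRing k] [CommRing R] [Algebra k R]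

/-- The action of `R ⊗ R` on `End_k(R)` in which `a ⊗ b` sends `δ` to `a ∘ δ ∘ b`. -/
noncomputable def tensorActionEnd : R ⊗[k] R →ₐ[k] Module.End k (Module.End k R) :=
  Algebra.TensorProduct.lift
    ((Algebra.lmul k (Module.End k R)).comp (Algebra.lmul k R))
    (AlgHom.ofLinearMap
      ((LinearMap.mul k (Module.End k R)).flip ∘ₗ (Algebra.lmul k R).toLinearMap)
      (by ext; simp)
      (fun a b => by ext δ c; simp [mul_assoc, mul_left_comm b]))
    (fun a b => by rw [commute_iff_eq]; ext δ c; simp)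

variable {k R}

theorem tensorActionEnd_one_tmul_sub_tmul_one (r : R) (δ : Module.End k R) :
    tensorActionEnd k R (1 ⊗ₜ r - r ⊗ₜ 1) δ =
      δ * LinearMap.mulLeft k r - LinearMap.mulLeft k r * δ := by
  rw [map_sub, tensorActionEnd, Algebra.TensorProduct.lift_tmul, Algebra.TensorProduct.lift_tmul]
  ext c
  simp

/-- An operator killed by the `n`-th power of the kernel of `R ⊗ R → R` has order `< n`. -/
theorem mem_diffOpLT_of_ideal_pow {n : ℕ} {δ : Module.End k R}
    (h : ∀ t ∈ KaehlerDifferential.ideal k R ^ n, tensorActionEnd k R t δ = 0) :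
    δ ∈ diffOpLT k R n := by
  induction n generalizing δ with
  | zero =>
    rw [diffOpLT, Submodule.mem_bot]
    simpa using h 1 (by simp)
  | succ n ih =>
    intro r
    refine ih fun t ht => ?_
    rw [← tensorActionEnd_one_tmul_sub_tmul_one, ← Module.End.mul_apply, ← map_mul]
    refine h _ ?_
    rw [pow_succ]
    exact Ideal.mul_mem_mul ht (KaehlerDifferential.one_smul_sub_smul_one_mem_ideal k r)

end FrobLinear

/-- Over a finitely generated algebra, a `k`-linear map which is linear over the `p ^ e`-th powers
is a differential operator: the kernel `J` of `R ⊗ R → R` is finitely generated, and its generators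
`1 ⊗ r - r ⊗ 1` have `p ^ e`-th powers `1 ⊗ r ^ p ^ e - r ^ p ^ e ⊗ 1`, which kill the map. -/
theorem IsFrobLinear.mem_diffOp {k : Type u} {R : Type v} [Field k] [CommRing R] [Algebra k R]
    [Algebra.FiniteType k R] {p : ℕ} [Fact p.Prime] [CharP k p] [CharP R p]
    {e : ℕ} {δ : Module.End k R} (hδ : IsFrobLinear p e δ) : δ ∈ DiffOp k R := by
  have : Nontrivial R := CharP.nontrivial_of_char_ne_one (Fact.out : p.Prime).ne_one
  have : ExpChar (R ⊗[k] R) p := by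
    have : CharP (R ⊗[k] R) p :=
      charP_of_injective_algebraMap (algebraMap k (R ⊗[k] R)).injective p
    exact ExpChar.prime Fact.out
  let I : Ideal (R ⊗[k] R) :=
    { carrier := {t | tensorActionEnd k R t δ = 0}
      zero_mem' := by simp
      add_mem' := fun {a b} (ha : _ = 0) (hb : _ = 0) =>
        show tensorActionEnd k R (a + b) δ = 0 by
          rw [map_add, LinearMap.add_apply, ha, hb, add_zero]
      smul_mem' := fun c a (ha : _ = 0) =>
        show tensorActionEnd k R (c * a) δ = 0 by
          rw [map_mul, Module.End.mul_apply, ha, map_zero] }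
  have hI : KaehlerDifferential.ideal k R ≤ I.radical := by
    rw [← KaehlerDifferential.span_range_eq_ideal, Ideal.span_le]
    rintro _ ⟨r, rfl⟩
    refine ⟨p ^ e, show tensorActionEnd k R ((1 ⊗ₜ r - r ⊗ₜ 1) ^ p ^ e) δ = 0 from ?_⟩
    rw [sub_pow_expChar_pow, Algebra.TensorProduct.tmul_pow, Algebra.TensorProduct.tmul_pow,
      one_pow, tensorActionEnd_one_tmul_sub_tmul_one]
    ext y
    simp [hδ r y]
  obtain ⟨n, hn⟩ := Ideal.exists_pow_le_of_le_radical_of_fg hI (KaehlerDifferential.ideal_fg k R)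
  exact ⟨n, mem_diffOpLT_of_ideal_pow fun t ht => hn ht⟩

/-! ### Noetherian graded algebras -/

section GradedNoetherian

variable {k : Type u} {R : Type v} [Field k] [CommRing R] [Algebra k R]
  (𝒜 : ℕ → Submodule k R) [GradedAlgebra 𝒜]

/-- If the ideal `R₊` is generated by elements `h` of degrees `d h`, then every element of
`𝒜 n`, `n > 0`, is a combination of such elements with homogeneous coefficients of degree
`n - d h`. -/
theorem le_iSup_map_mulRight {s : Finset R} {d : R → ℕ} (hd : ∀ h ∈ s, h ∈ 𝒜 (d h))
    (hs : (HomogeneousIdeal.irrelevant 𝒜).toIdeal ≤ Ideal.span s) {n : ℕ} (hn : 0 < n) :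
    𝒜 n ≤ ⨆ h : s, ⨆ _ : d h ≤ n, (𝒜 (n - d h)).map (LinearMap.mulRight k (h : R)) := by
  intro a ha
  have h1 : a ∈ Ideal.span (s : Set R) := hs <| by
    rw [HomogeneousIdeal.mem_iff, HomogeneousIdeal.mem_irrelevant_iff, GradedRing.proj_apply,
      DirectSum.decompose_of_mem_ne 𝒜 ha hn.ne']
  obtain ⟨c, -, hc⟩ := Submodule.mem_span_finset.1 h1
  have h2 : a = ∑ h ∈ s, (DirectSum.decompose 𝒜 (c h * h) n : R) := by
    have := congrArg (GradedRing.proj 𝒜 n) hc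
    rw [map_sum, GradedRing.proj_apply, DirectSum.decompose_of_mem_same 𝒜 ha] at this
    exact this.symm
  rw [h2]
  refine Submodule.sum_mem _ fun h hh => ?_
  rw [DirectSum.coe_decompose_mul_of_right_mem 𝒜 n (hd h hh)]
  split_ifs with hle
  · refine Submodule.mem_iSup_of_mem ⟨h, hh⟩ (Submodule.mem_iSup_of_mem hle ?_)
    exact ⟨_, SetLike.coe_mem _, rfl⟩
  · exact zero_mem _

theorem exists_finset_homogeneous_span_irrelevant [IsNoetherianRing R] :
    ∃ (s : Finset R) (d : R → ℕ), (∀ h ∈ s, 0 < d h ∧ h ∈ 𝒜 (d h)) ∧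
      (HomogeneousIdeal.irrelevant 𝒜).toIdeal ≤ Ideal.span s := by
  classical
  let S : Set R := {h | ∃ n, 0 < n ∧ h ∈ 𝒜 n}
  have hS : (HomogeneousIdeal.irrelevant 𝒜).toIdeal ≤ Ideal.span S := by
    intro a ha
    rw [HomogeneousIdeal.mem_iff, HomogeneousIdeal.mem_irrelevant_iff, GradedRing.proj_apply] at ha
    rw [← DirectSum.sum_support_decompose 𝒜 a]
    refine Ideal.sum_mem _ fun n _ => ?_
    rcases Nat.eq_zero_or_pos n with rfl | hn
    · rw [ha]; exact zero_mem _
    · exact Ideal.subset_span ⟨n, hn, SetLike.coe_mem _⟩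
  obtain ⟨s, hsS, hs⟩ := Submodule.fg_span_iff_fg_span_finset_subset S |>.1
    (IsNoetherian.noetherian (Ideal.span S))
  choose! d hd using fun (h : R) (hh : h ∈ S) => hh
  exact ⟨s, d, fun h hh => hd h (hsS hh), hS.trans hs.le⟩

/-- The pieces of a Noetherian graded algebra over `k = R₀` are finite-dimensional. -/
theorem finite_piece_of_isNoetherianRing [IsNoetherianRing R]
    (h0 : Function.Bijective (algebraMap k (𝒜 0))) (n : ℕ) : (𝒜 n).FG := by
  obtain ⟨s, d, hd, hs⟩ := exists_finset_homogeneous_span_irrelevant 𝒜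
  induction n using Nat.strong_induction_on with
  | _ n ih =>
    rcases Nat.eq_zero_or_pos n with rfl | hn
    · rw [← Module.Finite.iff_fg]
      exact Module.Finite.of_surjective (Algebra.linearMap k (𝒜 0)) h0.2
    · have hfg : (⨆ h : s, ⨆ _ : d h ≤ n,
          (𝒜 (n - d h)).map (LinearMap.mulRight k (h : R))).FG :=
        Submodule.fg_iSup _ fun h => Submodule.fg_iSup _ fun hle =>
          (ih _ (by have := (hd h h.2).1; omega)).map _
      exact hfg.of_le (le_iSup_map_mulRight 𝒜 (fun h hh => (hd h hh).2) hs hn)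

/-- A Noetherian graded algebra over `k = R₀` is finitely generated. -/
theorem finiteType_of_isNoetherianRing [IsNoetherianRing R]
    (h0 : Function.Bijective (algebraMap k (𝒜 0))) : Algebra.FiniteType k R := by
  obtain ⟨s, d, hd, hs⟩ := exists_finset_homogeneous_span_irrelevant 𝒜
  have key : ∀ n, 𝒜 n ≤ (Algebra.adjoin k (s : Set R)).toSubmodule := by
    intro n
    induction n using Nat.strong_induction_on with
    | _ n ih =>
      rcases Nat.eq_zero_or_pos n with rfl | hn
      · intro a ha
        obtain ⟨c, hc⟩ := h0.2 ⟨a, ha⟩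
        have hca : algebraMap k R c = a := congrArg Subtype.val hc
        rw [← hca]
        exact Subalgebra.algebraMap_mem _ c
      · refine (le_iSup_map_mulRight 𝒜 (fun h hh => (hd h hh).2) hs hn).trans ?_
        refine iSup_le fun h => iSup_le fun hle => ?_
        rintro _ ⟨c, hc, rfl⟩
        exact (Algebra.adjoin k (s : Set R)).mul_mem
          (ih _ (by have := (hd h h.2).1; omega) hc) (Algebra.subset_adjoin h.2)
  refine ⟨⟨s, top_le_iff.1 fun a _ => ?_⟩⟩
  classical
  rw [← DirectSum.sum_support_decompose 𝒜 a]
  exact sum_mem fun n _ => key n (SetLike.coe_mem _)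

end GradedNoetherian

/-! ### Generation of localizations -/

/-- If for every `f` some differential operator sends `x ^ (p ^ e - 1)` to `x ^ (p ^ e - p ^ f)`
for a suitable `e` then `1/x` generates `R_x`: that operator sends `1/x` to `1/x ^ p ^ f`. -/
theorem span_invSelf_eq_top {k : Type u} {R : Type v} [Field k] [CommRing R] [Algebra k R]
    (p : ℕ) [Fact p.Prime] [CharP R p] (x : R)
    (h : ∀ f : ℕ, ∃ e, f ≤ e ∧ ∃ δ : DiffOp k R, IsFrobLinear p e (δ : Module.End k R) ∧
      (δ : Module.End k R) (x ^ (p ^ e - 1)) = x ^ (p ^ e - p ^ f)) :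
    let _ : Module (DiffOp k R) (Localization.Away x) := DiffOp.locModule p k (Submonoid.powers x)
    Submodule.span (DiffOp k R) {(IsLocalization.Away.invSelf x : Localization.Away x)} = ⊤ := by
  let _ : Module (DiffOp k R) (Localization.Away x) := DiffOp.locModule p k (Submonoid.powers x)
  have hp : p.Prime := Fact.out
  rw [eq_top_iff]
  rintro m -
  -- an arbitrary fraction `y / x ^ n` is a multiple of `1 / x ^ p ^ n`
  obtain ⟨y, ⟨_, n, rfl⟩, rfl⟩ := IsLocalization.exists_mk'_eq (Submonoid.powers x) m
  obtain ⟨e, hfe, δ, hδ, hδx⟩ := h n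
  have hle : p ^ n ≤ p ^ e := Nat.pow_le_pow_right hp.pos hfe
  have hn : n ≤ p ^ n := (Nat.lt_pow_self hp.one_lt).le
  let μ : DiffOp k R := ⟨LinearMap.mulLeft k (y * x ^ (p ^ n - n)), 1, fun r => by
    rw [diffOpLT, Submodule.mem_bot, sub_eq_zero]; ext c; simp [mul_left_comm]⟩
  rw [Submodule.mem_span_singleton]
  refine ⟨μ * δ, ?_⟩
  have hF : IsFrobLinear p e ((μ * δ : DiffOp k R) : Module.End k R) := by
    intro r z
    simp only [Subalgebra.coe_mul, Module.End.mul_apply, hδ r z]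
    exact mul_left_comm _ _ _
  refine (DiffOp.locFun_mk' (M := Submonoid.powers x) p (μ * δ) hF 1
    ⟨x, Submonoid.mem_powers x⟩).trans ?_
  rw [IsLocalization.mk'_eq_iff_eq]
  congr 1
  simp only [mul_one, Subalgebra.coe_mul, Module.End.mul_apply, hδx, SubmonoidClass.coe_pow]
  change x ^ n * (y * x ^ (p ^ n - n) * x ^ (p ^ e - p ^ n)) = x ^ p ^ e * y
  obtain ⟨a, ha⟩ := Nat.exists_eq_add_of_le hle
  obtain ⟨b, hb⟩ := Nat.exists_eq_add_of_le hn
  rw [ha, Nat.add_sub_cancel_left, pow_add]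
  conv_rhs => rw [hb, pow_add]
  rw [show p ^ n - n = b by omega]
  ring

/-! ### The filtration of a graded module by degree -/

namespace QGradedModule

section Filtration

variable {A : Type u} [CommRing A] {σ : Type*} [SetLike σ A] {𝒜 : ℕ → σ}

/-- The elements of `N` all of whose homogeneous components have degree at most `β`. -/
def degreeLE (N : QGradedModule 𝒜) (β : ℚ) : AddSubgroup N.carrier :=
  ⨆ α : ℚ, ⨆ _ : α ≤ β, N.piece α

theorem piece_le_degreeLE (N : QGradedModule 𝒜) {α β : ℚ} (h : α ≤ β) :
    N.piece α ≤ N.degreeLE β :=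
  le_iSup₂_of_le (f := fun α (_ : α ≤ β) => N.piece α) α h le_rfl

theorem mem_degreeLE_of_iso {N N' : QGradedModule 𝒜} (Φ : N.Iso N') {β : ℚ} {m : N.carrier}
    (hm : m ∈ N.degreeLE β) : Φ.toLinearEquiv m ∈ N'.degreeLE β := by
  have h : N.degreeLE β ≤
      (N'.degreeLE β).comap (Φ.toLinearEquiv : N.carrier →ₗ[A] N'.carrier).toAddMonoidHom :=
    iSup₂_le fun α hα m hm => N'.piece_le_degreeLE hα ((Φ.mem_piece_iff α m).1 hm)
  exact h hm

theorem apply_mem_degreeLE {ι : Type} [Fintype ι] {N : ι → QGradedModule 𝒜} {β : ℚ}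
    {m : ∀ i, (N i).carrier} (hm : m ∈ (directSum N).degreeLE β) (i : ι) :
    m i ∈ (N i).degreeLE β := by
  have h : (directSum N).degreeLE β ≤
      ((N i).degreeLE β).comap (Pi.evalAddMonoidHom (fun i => (N i).carrier) i) :=
    iSup₂_le fun α hα m hm => (N i).piece_le_degreeLE hα (hm i trivial)
  exact h hm

theorem piece_eq_bot_of_iso_directSum {ι : Type} [Fintype ι] {N : QGradedModule 𝒜}
    {N' : ι → QGradedModule 𝒜} (Φ : N.Iso (directSum N')) {β : ℚ} (h : N.piece β = ⊥) (i : ι) :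
    (N' i).piece β = ⊥ := by
  classical
  rw [eq_bot_iff]
  intro u hu
  let v : (directSum N').carrier := (Pi.single i u : ∀ i, (N' i).carrier)
  have hv : v ∈ (directSum N').piece β := by
    intro i' _
    by_cases hi : i' = i
    · subst hi
      simpa [v] using hu
    · simp [v, Pi.single_eq_of_ne hi]
  rw [← Φ.toLinearEquiv.apply_symm_apply v, ← Φ.mem_piece_iff, h, AddSubgroup.mem_bot,
    LinearEquiv.map_eq_zero_iff] at hv
  exact (Pi.single_eq_same (M := fun i => (N' i).carrier) i u).symm.trans (congrFun hv i)

theorem degreeLE_mono (N : QGradedModule 𝒜) : Monotone N.degreeLE := fun _ _ h =>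
  iSup₂_le fun _ hα => N.piece_le_degreeLE (hα.trans h)

theorem degreeLE_shift_le (N : QGradedModule 𝒜) (β d : ℚ) :
    (N.shift β).degreeLE d ≤ N.degreeLE (β + d) :=
  iSup₂_le fun α hα => N.piece_le_degreeLE (α := β + α) (by linarith)

/-- If a shift `N(β)` lives in nonnegative degrees, then `β` is at most the degree of any nonzero
homogeneous element of `N`. Hence the parts of degree `≤ d` of all such shifts lie in a common
step of the filtration of `N`. -/
theorem exists_degreeLE_shift_le (N : QGradedModule 𝒜) (d : ℚ) :
    ∃ D : ℚ, ∀ β : ℚ, (∀ α < 0, (N.shift β).piece α = ⊥) →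
      (N.shift β).degreeLE d ≤ N.degreeLE D := by
  by_cases h : ∃ γ, N.piece γ ≠ ⊥
  · obtain ⟨γ, hγ⟩ := h
    refine ⟨γ + d, fun β hβ => (N.degreeLE_shift_le β d).trans (N.degreeLE_mono ?_)⟩
    have : ¬ γ - β < 0 := fun hlt => hγ <| by
      have := hβ _ hlt
      rwa [show (N.shift β).piece (γ - β) = N.piece (β + (γ - β)) from rfl,
        add_sub_cancel] at this
    linarith
  · push Not at h
    refine ⟨0, fun β _ => (N.degreeLE_shift_le β d).trans ?_⟩
    exact iSup₂_le fun α _ => by rw [h]; exact bot_le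

variable [AddSubgroupClass σ A]

theorem mem_degreeLE_frob [GradedRing 𝒜] (p : ℕ) [hp : Fact p.Prime] [CharP A p] (e : ℕ)
    (N : QGradedModule 𝒜) {β : ℚ} {m : N.carrier} (hm : m ∈ N.degreeLE (p ^ e * β)) :
    (show (N.frob p e).carrier from m) ∈ (N.frob p e).degreeLE β := by
  have hq : (0 : ℚ) < (p : ℚ) ^ e := pow_pos (Nat.cast_pos.2 hp.out.pos) e
  have h : N.degreeLE (p ^ e * β) ≤
      (show AddSubgroup N.carrier from (N.frob p e).degreeLE β) := by
    refine iSup₂_le fun α hα m hm => ?_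
    refine (N.frob p e).piece_le_degreeLE (α := α / p ^ e) ((div_le_iff₀' hq).2 hα) ?_
    change m ∈ N.piece (p ^ e * (α / p ^ e))
    rwa [mul_div_cancel₀ _ hq.ne']
  exact h hm

variable (𝒜) [GradedRing 𝒜]

theorem ofRing_piece_natCast (n : ℕ) (a : A) : a ∈ (ofRing 𝒜).piece n ↔ a ∈ 𝒜 n := by
  change a ∈ Function.extend (fun n : ℕ => (n : ℚ)) (fun n => AddSubgroup.ofClass (𝒜 n)) ⊥ (n : ℚ)
    ↔ _
  rw [Nat.cast_injective.extend_apply]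
  rfl

theorem ofRing_piece_of_neg {α : ℚ} (hα : α < 0) : (ofRing 𝒜).piece α = ⊥ := by
  refine Function.extend_apply' (f := fun n : ℕ => (n : ℚ))
    (fun n => AddSubgroup.ofClass (𝒜 n)) (⊥ : ℚ → AddSubgroup A) α ?_
  rintro ⟨n, rfl⟩
  exact absurd hα (not_lt.2 n.cast_nonneg)

theorem mul_mem_degreeLE_ofRing {n : ℕ} {β : ℚ} {a b : A} (ha : a ∈ 𝒜 n)
    (hb : b ∈ (ofRing 𝒜).degreeLE β) : a * b ∈ (ofRing 𝒜).degreeLE (n + β) := by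
  have h : (ofRing 𝒜).degreeLE β ≤
      ((ofRing 𝒜).degreeLE (n + β)).comap (AddMonoidHom.mulLeft a) :=
    iSup₂_le fun α hα m hm =>
      (ofRing 𝒜).piece_le_degreeLE (by linarith) ((ofRing 𝒜).smul_mem ha hm)
  exact h hb

/-- The degree of `x ^ n` is at most `n` times the degree of `x`. -/
theorem exists_pow_mem_degreeLE_ofRing (x : A) :
    ∃ d : ℕ, ∀ n : ℕ, x ^ n ∈ (ofRing 𝒜).degreeLE (n * d) := by
  classical
  refine ⟨(DirectSum.decompose 𝒜 x).support.sup id, fun n => ?_⟩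
  induction n with
  | zero =>
    refine (ofRing 𝒜).piece_le_degreeLE (α := ((0 : ℕ) : ℚ)) (by simp) ?_
    exact (ofRing_piece_natCast 𝒜 0 (x ^ 0)).2 (pow_zero x ▸ SetLike.GradedOne.one_mem)
  | succ n ih =>
    have hx : x ^ (n + 1) =
        ∑ i ∈ (DirectSum.decompose 𝒜 x).support, (DirectSum.decompose 𝒜 x i : A) * x ^ n := by
      rw [← Finset.sum_mul, DirectSum.sum_support_decompose, pow_succ']
    let G : AddSubgroup A := (ofRing 𝒜).degreeLE
      ((n + 1 : ℕ) * ((DirectSum.decompose 𝒜 x).support.sup id : ℕ))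
    change x ^ (n + 1) ∈ G
    rw [hx]
    refine G.sum_mem fun i hi => ?_
    refine (ofRing 𝒜).degreeLE_mono ?_ (mul_mem_degreeLE_ofRing 𝒜 (SetLike.coe_mem _) ih)
    have hi' : i ≤ (DirectSum.decompose 𝒜 x).support.sup id :=
      Finset.le_sup (f := id) hi
    have hi'' : (i : ℚ) ≤ ((DirectSum.decompose 𝒜 x).support.sup id : ℕ) := Nat.cast_le.2 hi'
    push_cast
    linarith

end Filtration

/-! ### Finite generation and the descending chain condition in bounded degrees -/

section Finite

variable {K : Type w} {A : Type u} [Field K] [CommRing A] [Algebra K A] {𝒜 : ℕ → Submodule K A}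

theorem exists_finset_homogeneous_span (N : QGradedModule 𝒜) [Module.Finite A N.carrier] :
    ∃ (s : Finset N.carrier) (γ : N.carrier → ℚ), (∀ g ∈ s, g ∈ N.piece (γ g)) ∧
      Submodule.span A (s : Set N.carrier) = ⊤ := by
  let S : Set N.carrier := {g | ∃ γ, g ∈ N.piece γ}
  have hS : Submodule.span A S = ⊤ := by
    rw [eq_top_iff]
    have h1 := ((isInternal_iff_addSubgroup _).1 N.isInternal).2
    have h2 : (⨆ γ, N.piece γ) ≤ (Submodule.span A S).toAddSubgroup :=
      iSup_le fun γ g hg => Submodule.subset_span ⟨γ, hg⟩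
    rw [h1] at h2
    exact fun m _ => h2 trivial
  obtain ⟨s, hsS, hs⟩ := Submodule.fg_span_iff_fg_span_finset_subset S |>.1
    (hS ▸ Module.Finite.fg_top)
  choose! γ hγ using fun (g : N.carrier) (hg : g ∈ S) => hg
  exact ⟨s, γ, fun g hg => hγ g (hsS hg), hs.symm.trans hS⟩

/-- The part of degree at most `D` of a finitely generated graded module is contained in the
subspace spanned by the products of the generators with the homogeneous elements of the ring of
bounded degree. -/
theorem exists_fg_degreeLE_le [GradedAlgebra 𝒜] (hfin : ∀ n, (𝒜 n).FG) (N : QGradedModule 𝒜)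
    [Module.Finite A N.carrier] [Module K N.carrier] [IsScalarTower K A N.carrier] (D : ℚ) :
    ∃ V : Submodule K N.carrier, V.FG ∧ ∀ m ∈ N.degreeLE D, m ∈ V := by
  classical
  obtain ⟨s, γ, hγ, hs⟩ := N.exists_finset_homogeneous_span
  obtain ⟨B, hB⟩ : ∃ B : ℕ, ∀ g ∈ s, D - γ g ≤ B := by
    refine ⟨s.sup fun g => ⌈D - γ g⌉₊, fun g hg => (Nat.le_ceil _).trans ?_⟩
    exact Nat.cast_le.2 (Finset.le_sup (f := fun g => ⌈D - γ g⌉₊) hg)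
  let V : Submodule K N.carrier := ⨆ g : s, ⨆ n : Fin (B + 1),
    (𝒜 n).map ((LinearMap.toSpanSingleton A N.carrier (g : N.carrier)).restrictScalars K)
  refine ⟨V, Submodule.fg_iSup _ fun g => Submodule.fg_iSup _ fun n => (hfin n).map _, ?_⟩
  let _ := N.isInternal.chooseDecomposition
  -- the homogeneous components of degree `≤ D` of every element lie in `V`
  have key : ∀ m : N.carrier, ∀ α ≤ D, (DirectSum.decompose N.piece m α : N.carrier) ∈ V := by
    have hadd : ∀ m m' : N.carrier,
        (∀ α ≤ D, (DirectSum.decompose N.piece m α : N.carrier) ∈ V) →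
        (∀ α ≤ D, (DirectSum.decompose N.piece m' α : N.carrier) ∈ V) →
        ∀ α ≤ D, (DirectSum.decompose N.piece (m + m') α : N.carrier) ∈ V := by
      intro m m' h h' α hα
      rw [DirectSum.decompose_add]
      exact V.add_mem (h α hα) (h' α hα)
    have hzero : ∀ α ≤ D, (DirectSum.decompose N.piece (0 : N.carrier) α : N.carrier) ∈ V := by
      intro α _
      rw [DirectSum.decompose_zero]
      exact V.zero_mem
    have hsmul : ∀ (a : A), ∀ g ∈ s, ∀ α ≤ D,
        (DirectSum.decompose N.piece (a • g) α : N.carrier) ∈ V := by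
      intro a g hg
      induction a using DirectSum.Decomposition.inductionOn 𝒜 with
      | zero => rw [zero_smul]; exact hzero
      | add a b ha hb => rw [add_smul]; exact hadd _ _ ha hb
      | @homogeneous n a =>
        intro α hα
        have hag := N.smul_mem a.2 (hγ g hg)
        by_cases hn : (n : ℚ) + γ g = α
        · rw [hn] at hag
          rw [DirectSum.decompose_of_mem_same _ hag]
          have hnB : n < B + 1 := by
            have h1 := hB g hg
            have h2 : (n : ℚ) ≤ B := by linarith
            exact Nat.lt_succ_of_le (by exact_mod_cast h2)
          refine Submodule.mem_iSup_of_mem ⟨g, hg⟩ (Submodule.mem_iSup_of_mem ⟨n, hnB⟩ ?_)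
          exact ⟨a, a.2, rfl⟩
        · rw [DirectSum.decompose_of_mem_ne _ hag hn]
          exact V.zero_mem
    intro m
    obtain ⟨c, -, rfl⟩ := Submodule.mem_span_finset.1 (hs ▸ Submodule.mem_top (x := m))
    exact Finset.sum_induction _
      (fun m => ∀ α ≤ D, (DirectSum.decompose N.piece m α : N.carrier) ∈ V) hadd hzero
      fun g hg => hsmul (c g) g hg
  have hle : N.degreeLE D ≤ V.toAddSubgroup := by
    refine iSup₂_le fun α hα m hm => ?_
    have := key m α hα
    rwa [DirectSum.decompose_of_mem_same _ hm] at this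
  exact fun m hm => hle hm

/-- A descending chain of submodules of a finitely generated graded module is stationary in
bounded degrees. -/
theorem exists_stationary_degreeLE [GradedAlgebra 𝒜] (hfin : ∀ n, (𝒜 n).FG)
    (N : QGradedModule 𝒜) [Module.Finite A N.carrier] {L : ℕ → Submodule A N.carrier}
    (hL : Antitone L) (D : ℚ) :
    ∃ e₀, ∀ e ≥ e₀, ∀ m ∈ N.degreeLE D, m ∈ L e₀ → m ∈ L e := by
  let _ : Module K N.carrier := Module.compHom _ (algebraMap K A)
  have : IsScalarTower K A N.carrier :=
    IsScalarTower.of_algebraMap_smul fun _ _ => rfl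
  obtain ⟨V, hV, hDV⟩ := N.exists_fg_degreeLE_le hfin D
  have := Module.Finite.iff_fg.2 hV
  let f : ℕ →o (Submodule K V)ᵒᵈ :=
    { toFun := fun e => OrderDual.toDual (((L e).restrictScalars K).comap V.subtype)
      monotone' := fun e e' h => Submodule.comap_mono (f := V.subtype)
        (Submodule.restrictScalars_mono (S := K) (hL h)) }
  obtain ⟨e₀, he₀⟩ := IsArtinian.monotone_stabilizes f
  refine ⟨e₀, fun e he m hm hmL => ?_⟩
  have h : (⟨m, hDV m hm⟩ : V) ∈ ((L e₀).restrictScalars K).comap V.subtype := hmL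
  have h' : (⟨m, hDV m hm⟩ : V) ∈ ((L e).restrictScalars K).comap V.subtype := by
    have := congrArg OrderDual.ofDual (he₀ e he)
    change Submodule.comap _ _ = Submodule.comap _ _ at this
    rwa [this] at h
  exact h'

end Finite

end QGradedModule

/-! ### Endomorphisms of Frobenius push-forwards -/

section FrobModule

variable {A : Type u} [CommRing A] (p : ℕ) [hp : Fact p.Prime] [CharP A p]

/-- The `A`-linear map `ᵉA → ᵉ⁺ᶠA` given by the `f`-th iterate of the Frobenius map. -/
noncomputable def FrobModule.frobenius (e f : ℕ) :
    FrobModule p e A →ₗ[A] FrobModule p (e + f) A where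
  toFun := iterateFrobenius A p f
  map_add' := map_add (iterateFrobenius A p f)
  map_smul' c m := by
    change (c ^ p ^ e * (show A from m)) ^ p ^ f = c ^ p ^ (e + f) * (show A from m) ^ p ^ f
    rw [mul_pow, ← pow_mul, ← pow_add]

/-- Multiplication by an element of `A`, as an endomorphism of `ᵉA`. -/
def FrobModule.mulLeft (e : ℕ) (c : A) : FrobModule p e A →ₗ[A] FrobModule p e A where
  toFun := fun m => c * (show A from m)
  map_add' := mul_add c
  map_smul' a m := mul_left_comm c (a ^ p ^ e) m

/-- The submodule of `N` formed by the images of `x ^ (p ^ e - 1)` under the `A`-linear maps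
`ᵉA → N`. -/
noncomputable def frobImage (x : A) (N : Type*) [AddCommGroup N] [Module A N] (e : ℕ) :
    Submodule A N :=
  LinearMap.range (LinearMap.applyₗ (R := A) (M := FrobModule p e A) (M₂ := N)
    (show FrobModule p e A from x ^ (p ^ e - 1)))

variable {p} {x : A} {N : Type*} [AddCommGroup N] [Module A N]

theorem mem_frobImage {e : ℕ} {m : N} : m ∈ frobImage p x N e ↔
    ∃ g : FrobModule p e A →ₗ[A] N, g (show FrobModule p e A from x ^ (p ^ e - 1)) = m :=
  Iff.rfl

/-- Every linear map on `ᵉ⁺ᶠA` can be composed with the `f`-th iterate of Frobenius `ᵉA → ᵉ⁺ᶠA`,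
which sends `x ^ (p ^ e - 1)` to `x ^ (p ^ (e + f) - p ^ f)`. -/
theorem apply_mem_frobImage {e f : ℕ} (g : FrobModule p (e + f) A →ₗ[A] N) :
    g (show FrobModule p (e + f) A from x ^ (p ^ (e + f) - p ^ f)) ∈ frobImage p x N e := by
  refine mem_frobImage.2 ⟨g ∘ₗ FrobModule.frobenius p e f, ?_⟩
  change g ((x ^ (p ^ e - 1)) ^ p ^ f : A) = g (x ^ (p ^ (e + f) - p ^ f) : A)
  rw [← pow_mul, Nat.sub_mul, one_mul, pow_add]

/-- Compose linear maps on `ᵉ⁺¹A` with the map `ᵉA → ᵉ⁺¹A`, `a ↦ x ^ (p - 1) * a ^ p`. -/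
theorem frobImage_antitone : Antitone (frobImage p x N) := by
  refine antitone_nat_of_succ_le fun e m hm => ?_
  obtain ⟨g, rfl⟩ := mem_frobImage.1 hm
  have h := apply_mem_frobImage (x := x) (f := 1) (g ∘ₗ FrobModule.mulLeft p (e + 1) (x ^ (p - 1)))
  change g (x ^ (p - 1) * x ^ (p ^ (e + 1) - p ^ 1) : A) ∈ _ at h
  have hle : p ^ 1 ≤ p ^ (e + 1) := Nat.pow_le_pow_right hp.out.pos (by omega)
  have hp1 := hp.out.one_lt
  rw [pow_one] at hle h
  rw [← pow_add, show p - 1 + (p ^ (e + 1) - p) = p ^ (e + 1) - 1 by omega] at h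
  exact h

end FrobModule

open QGradedModule in
/-- The submodules `frobImage p x M_i e` of the modules `M_i` of which all `ᵉA` are composed become
stationary in bounded degrees, from `e = e₀` on, say. The components of `x ^ (p ^ e - p ^ f)`,
`e = e₀ + f`, have bounded degrees and lie in the submodules with index `e₀`, hence in those with
index `e`; this means that they are images of `x ^ (p ^ e - 1)`. -/
theorem HasFiniteGradedFRepType.exists_end_apply_eq {K : Type w} {A : Type u} [Field K]
    [CommRing A] [Algebra K A] (p : ℕ) [hp : Fact p.Prime] [CharP A p] (𝒜 : ℕ → Submodule K A)
    [GradedAlgebra 𝒜] (hfin : ∀ n, (𝒜 n).FG) (hF : HasFiniteGradedFRepType p 𝒜) (x : A) (f : ℕ) :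
    ∃ e, f ≤ e ∧ ∃ δ : FrobModule p e A →ₗ[A] FrobModule p e A,
      δ (show FrobModule p e A from x ^ (p ^ e - 1)) =
        (show FrobModule p e A from x ^ (p ^ e - p ^ f)) := by
  obtain ⟨s, M, hM, hiso⟩ := hF
  obtain ⟨d, hd⟩ := exists_pow_mem_degreeLE_ofRing 𝒜 x
  choose D hD using fun i => (M i).exists_degreeLE_shift_le d
  choose e₀ he₀ using fun i => have := hM i
    (M i).exists_stationary_degreeLE hfin (frobImage_antitone (p := p) (x := x)) (D i)
  let e₁ := Finset.univ.sup e₀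
  have he₁ : ∀ i, e₀ i ≤ e₁ := fun i => Finset.le_sup (Finset.mem_univ i)
  refine ⟨e₁ + f, Nat.le_add_left _ _, ?_⟩
  set e := e₁ + f
  obtain ⟨n, α, ⟨Φ⟩⟩ := hiso e
  have hq : (0 : ℚ) < (p : ℚ) ^ e := pow_pos (Nat.cast_pos.2 hp.out.pos) e
  -- the isomorphism without its grading; shifting does not change the underlying modules
  let Ψ : FrobModule p e A ≃ₗ[A] ∀ ij : (i : Fin s) × Fin (n i), (M ij.1).carrier :=
    Φ.toLinearEquiv
  let y : FrobModule p e A := (x ^ (p ^ e - p ^ f) : A)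
  -- as an element of `ᵉA`, the power `y` has degree at most `d`
  have hy : y ∈ ((ofRing 𝒜).frob p e).degreeLE d := by
    refine mem_degreeLE_frob p e _ ((ofRing 𝒜).degreeLE_mono ?_ (hd _))
    have h : ((p ^ e - p ^ f : ℕ) : ℚ) ≤ (p ^ e : ℕ) := Nat.cast_le.2 (Nat.sub_le _ _)
    push_cast at h
    exact mul_le_mul_of_nonneg_right h d.cast_nonneg
  -- the summands live in nonnegative degrees, since `ᵉA` does
  have hneg : ∀ (ij : (i : Fin s) × Fin (n i)), ∀ β < 0,
      ((M ij.1).shift (α ij.1 ij.2)).piece β = ⊥ :=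
    fun ij β hβ => piece_eq_bot_of_iso_directSum Φ
      (ofRing_piece_of_neg 𝒜 (mul_neg_of_pos_of_neg hq hβ)) ij
  have hcomp : ∀ ij : (i : Fin s) × Fin (n i), ∃ g : FrobModule p e A →ₗ[A] (M ij.1).carrier,
      g (show FrobModule p e A from x ^ (p ^ e - 1)) = Ψ y ij := by
    intro ij
    refine mem_frobImage.1 (he₀ ij.1 e ((he₁ _).trans (Nat.le_add_right _ _)) _ ?_ ?_)
    · exact hD _ _ (hneg ij) (apply_mem_degreeLE (mem_degreeLE_of_iso Φ hy) ij)
    · exact frobImage_antitone (he₁ ij.1)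
        (apply_mem_frobImage (x := x) (LinearMap.proj ij ∘ₗ Ψ.toLinearMap))
  choose g hg using hcomp
  refine ⟨Ψ.symm.toLinearMap ∘ₗ LinearMap.pi g, ?_⟩
  exact (LinearEquiv.symm_apply_eq Ψ).2 (funext hg)

/-! ### Descent along a field extension -/

/-- A map on `K ⊗ R` restricts to a map on `R`, by means of a `k`-linear retraction of `k → K`. -/
theorem exists_isFrobLinear_of_baseChange {k : Type u} {R : Type v} {K : Type w} [Field k]
    [CommRing R] [Algebra k R] [Field K] [Algebra k K] (p : ℕ) [Fact p.Prime] [CharP R p]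
    [CharP K p] [PerfectRing K p] (x y : R) (e : ℕ)
    (δ : FrobModule p e (K ⊗[k] R) →ₗ[K ⊗[k] R] FrobModule p e (K ⊗[k] R))
    (hδ : δ (show FrobModule p e (K ⊗[k] R) from 1 ⊗ₜ x) =
      (show FrobModule p e (K ⊗[k] R) from 1 ⊗ₜ y)) :
    ∃ ε : Module.End k R, IsFrobLinear p e ε ∧ ε x = y := by
  have hlin : ∀ (a b : K ⊗[k] R), (show K ⊗[k] R from δ (a ^ p ^ e * b : K ⊗[k] R)) =
      a ^ p ^ e * (show K ⊗[k] R from δ b) := fun a b => δ.map_smul a b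
  -- since `K` is perfect, its elements are `p ^ e`-th powers and `δ` is `K`-linear
  let δ' : K ⊗[k] R →ₗ[K] K ⊗[k] R :=
    { toFun := fun b => δ b
      map_add' := δ.map_add
      map_smul' := fun c b => by
        obtain ⟨c, rfl⟩ := (bijective_iterateFrobenius K p e).2 c
        have h : ∀ t : K ⊗[k] R, iterateFrobenius K p e c • t =
            algebraMap K (K ⊗[k] R) c ^ p ^ e * t := fun t => by
          rw [iterateFrobenius_def, Algebra.smul_def, map_pow]
        exact (congrArg δ (h b)).trans ((hlin _ _).trans (h _).symm) }
  obtain ⟨ℓ, hℓ⟩ := (Algebra.linearMap k K).exists_leftInverse_of_injective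
    (LinearMap.ker_eq_bot.2 (algebraMap k K).injective)
  have hℓ1 : ℓ 1 = 1 := by simpa using LinearMap.congr_fun hℓ 1
  let ret : K ⊗[k] R →ₗ[k] R := TensorProduct.lid k R ∘ₗ ℓ.rTensor R
  have hret1 : ∀ r : R, ret (1 ⊗ₜ r) = r := fun r => by simp [ret, hℓ1]
  have hret : ∀ (r : R) (t : K ⊗[k] R), ret ((1 ⊗ₜ r) * t) = r * ret t := by
    intro r t
    induction t with
    | zero => simp
    | add a b ha hb => rw [mul_add, map_add, map_add, ha, hb, mul_add]
    | tmul c b => simp [ret]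
  refine ⟨ret ∘ₗ δ'.restrictScalars k ∘ₗ TensorProduct.mk k K R 1, fun r z => ?_, ?_⟩
  · change ret (δ' (1 ⊗ₜ (r ^ p ^ e * z))) = r ^ p ^ e * ret (δ' (1 ⊗ₜ z))
    have h1 : (1 : K) ⊗ₜ[k] (r ^ p ^ e * z) = (1 ⊗ₜ[k] r) ^ p ^ e * (1 ⊗ₜ[k] z) := by
      simp [Algebra.TensorProduct.tmul_pow]
    have h2 : δ' (1 ⊗ₜ (r ^ p ^ e * z)) = (1 ⊗ₜ (r ^ p ^ e)) * δ' (1 ⊗ₜ z) := by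
      rw [h1]
      refine (hlin _ _).trans ?_
      rw [Algebra.TensorProduct.tmul_pow, one_pow]
      rfl
    rw [h2, hret]
  · change ret (δ' (1 ⊗ₜ x)) = y
    rw [show δ' (1 ⊗ₜ x) = 1 ⊗ₜ y from hδ, hret1]

theorem mainTheorem1 {k : Type u} {R : Type v} {K : Type w} [Field k] [CommRing R] [Algebra k R]
    [Field K] [Algebra k K] (p : ℕ) [Fact p.Prime] [CharP k p] [CharP R p] [CharP K p]
    [PerfectRing K p] [IsPerfectClosure (algebraMap k K) p]
    [IsNoetherianRing R] (𝒜 : ℕ → Submodule k R) [GradedAlgebra 𝒜]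
    (h0 : Function.Bijective (algebraMap k (𝒜 0)))
    (hF : HasFiniteGradedFRepType p (fun n => (𝒜 n).baseChange K))
    (x : R) (hx : x ∈ nonZeroDivisors R) :
    letI : Module (DiffOp k R) (Localization.Away x) := DiffOp.locModule p k (Submonoid.powers x)
    Submodule.span (DiffOp k R) {(IsLocalization.Away.invSelf x : Localization.Away x)} = ⊤ := by
  have := finiteType_of_isNoetherianRing 𝒜 h0
  have hfin : ∀ n, ((𝒜 n).baseChange K).FG := fun n => by
    obtain ⟨s, hs⟩ := finite_piece_of_isNoetherianRing 𝒜 h0 n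
    classical
    rw [← hs, Submodule.baseChange_span]
    exact Submodule.fg_span (s.finite_toSet.image _)
  refine span_invSelf_eq_top p x fun f => ?_
  obtain ⟨e, hfe, δ, hδ⟩ := hF.exists_end_apply_eq p _ hfin (1 ⊗ₜ x) f
  rw [Algebra.TensorProduct.tmul_pow, Algebra.TensorProduct.tmul_pow, one_pow, one_pow] at hδ
  obtain ⟨ε, hε, hεx⟩ := exists_isFrobLinear_of_baseChange p _ _ e δ hδ
  exact ⟨e, hfe, ⟨ε, hε.mem_diffOp⟩, hε, hεx⟩
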